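/- Let $0<\beta<1$, $1<\alpha<2$, and let $E_\beta(z)=\sum_{n\ge 0} z^n/\Gamma(\beta n+1)$ be the Mittag-Leffler function. Let $B_{\beta,\alpha}=(B_{\beta,\alpha}(t))_{t\ge0}$ be a generalized grey Brownian motion, i.e. a process with almost surely continuous paths such that $B_{\beta,\alpha}(0)=0$ a.s. and, for all $0\le t_1<\dots<t_n$ and $\theta\in\mathbb R^n$, $$\mathbb E\Big(e^{i\sum_{k}\theta_kB_{\beta,\alpha}(t_k)}\Big)=E_\beta\Big(-\tfrac12\theta^\top\Sigma_\alpha\theta\Big),\qquad \Sigma_\alpha=\Big(\tfrac12\big(t_k^\alpha+t_j^\alpha-|t_k-t_j|^\alpha\big)\Big)_{k,j=1}^n .$$ Let (possibly on another probability space) $W$ be a standard Brownian motion and $S_\beta=(S_\beta(t))_{t\ge0}$ a strictly increasing $\beta$-stable subordinator independent of $W$, with $\mathbb E(e^{-\theta S_\beta(t)})=e^{-t\theta^\beta}$ for $\theta>0$; let $U_\beta(t)=\inf\{s\ge0: S_\beta(s)>t\}$ be its inverse, and put $X_{\beta,\alpha}(t)=W\big(U_\beta(t^{\alpha/\beta})\big)$,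 $t\ge0$. Then $B_{\beta,\alpha}$ and $X_{\beta,\alpha}$ have only the same one-dimensional distributions: (a) For every $t\ge0$, $B_{\beta,\alpha}(t)$ and $X_{\beta,\alpha}(t)$ have the same distribution, and for every $\theta\in\mathbb R$ $$\mathbb E\big(e^{i\theta B_{\beta,\alpha}(t)}\big)=\mathbb E\big(e^{i\theta X_{\beta,\alpha}(t)}\big)=E_\beta\Big(-\frac{\theta^2}{2}t^\alpha\Big).$$ (b) For all $0\le s\le t$ the increments are square integrable and $$\mathbb E\big[(B_{\beta,\alpha}(t)-B_{\beta,\alpha}(s))^2\big]=\frac{|t-s|^\alpha}{\Gamma(\beta+1)},\qquad \mathbb E\big[(X_{\beta,\alpha}(t)-X_{\beta,\alpha}(s))^2\big]=\frac{t^\alpha-s^\alpha}{\Gamma(\beta+1)},$$ and these two second moments are different whenever $0<s<t$. (c) The higher-order distributions differ: for any times $t_1,\dots,t_n\ge0$ among which there are two distinct positive ones, the joint distributions of $(B_{\beta,\alpha}(t_1),\dots,B_{\beta,\alpha}(t_n))$ and $(X_{\beta,\alpha}(t_1),\dots,X_{\beta,\alpha}(t_n))$ are different. -/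

import Mathlib

open MeasureTheory ProbabilityTheory
open scoped NNReal Matrix

noncomputable section

/-- The Mittag-Leffler function `E_β(z) = ∑ zⁿ / Γ(β n + 1)`; the series converges absolutely
for every complex `z` as soon as `β > 0`. -/
def mittagLeffler (β : ℝ) (z : ℂ) : ℂ :=
  ∑' n : ℕ, z ^ n / (Real.Gamma (β * n + 1) : ℂ)

/-- The matrix `Σ_α = (½ (t_k^α + t_j^α - |t_k - t_j|^α))_{k,j}`. -/
def ggBmMatrix (α : ℝ) {n : ℕ} (t : Fin n → ℝ≥0) : Matrix (Fin n) (Fin n) ℝ :=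
  Matrix.of fun k j =>
    ((t k : ℝ) ^ α + (t j : ℝ) ^ α - |(t k : ℝ) - (t j : ℝ)| ^ α) / 2

/-- `B` is a generalized grey Brownian motion with parameters `β`, `α` under `P`: a process with
almost surely continuous paths, started at `0`, whose finite-dimensional characteristic functions
are `θ ↦ E_β(-½ θᵀ Σ_α θ)`. -/
structure IsGeneralizedGreyBM {Ω : Type*} [MeasurableSpace Ω] (β α : ℝ) (B : ℝ≥0 → Ω → ℝ)
    (P : Measure Ω) : Prop where
  aemeasurable : ∀ t, AEMeasurable (B t) P
  continuous_paths : ∀ᵐ ω ∂P, Continuous fun t => B t ω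
  start_zero : ∀ᵐ ω ∂P, B 0 ω = 0
  charFun_eq : ∀ (n : ℕ) (t : Fin n → ℝ≥0), StrictMono t → ∀ θ : Fin n → ℝ,
    ∫ ω, Complex.exp (Complex.I * ((∑ k, θ k * B (t k) ω : ℝ) : ℂ)) ∂P =
      mittagLeffler β ((-(1 / 2) * (θ ⬝ᵥ (ggBmMatrix α t *ᵥ θ)) : ℝ) : ℂ)

/-- `S` is a strictly increasing `β`-stable subordinator under `P`: a process started at `0`, with
independent and stationary increments, almost surely strictly increasing and right-continuous
paths (left limits are automatic by monotonicity), and Laplace transform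
`E exp(-θ S(t)) = exp(-t θ^β)`. -/
structure IsStableSubordinator {Ω : Type*} [MeasurableSpace Ω] (β : ℝ) (S : ℝ≥0 → Ω → ℝ)
    (P : Measure Ω) : Prop where
  aemeasurable : ∀ t, AEMeasurable (S t) P
  start_zero : ∀ᵐ ω ∂P, S 0 ω = 0
  indep_increments : HasIndepIncrements S P
  stationary_increments : ∀ s h : ℝ≥0,
    IdentDistrib (fun ω => S (s + h) ω - S s ω) (S h) P P
  strictMono_paths : ∀ᵐ ω ∂P, StrictMono fun t => S t ω
  rightContinuous_paths : ∀ᵐ ω ∂P, ∀ t : ℝ≥0,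
    ContinuousWithinAt (fun u => S u ω) (Set.Ici t) t
  laplace_eq : ∀ (t : ℝ≥0) (θ : ℝ), 0 < θ →
    ∫ ω, Real.exp (-θ * S t ω) ∂P = Real.exp (-(t : ℝ) * θ ^ β)

/-- The inverse (first-passage) process `U(t) = inf {s ≥ 0 | S(s) > t}`. -/
def inverseProcess {Ω : Type*} (S : ℝ≥0 → Ω → ℝ) (t : ℝ≥0) (ω : Ω) : ℝ≥0 :=
  sInf {s : ℝ≥0 | (t : ℝ) < S s ω}

/-- The time change `U_{β,α}(t) = U(t^{α/β})`, where `U` is the inverse of `S`. -/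
def timeChange {Ω : Type*} (β α : ℝ) (S : ℝ≥0 → Ω → ℝ) (t : ℝ≥0) (ω : Ω) : ℝ≥0 :=
  inverseProcess S (t ^ (α / β)) ω

/-- The time-changed process `X_{β,α}(t) = W(U_{β,α}(t))`. -/
def timeChangedProcess {Ω : Type*} (β α : ℝ) (W S : ℝ≥0 → Ω → ℝ) (t : ℝ≥0) (ω : Ω) : ℝ :=
  W (timeChange β α S t ω) ω

end

/-! The Laplace transform gives `S s` the law of `s ^ (1 / β) * S 1`. Since `U(τ) > a` means that
`S` is still at most `τ` slightly after time `a`, `U(τ)` has the law of `(τ / S 1) ^ β`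
(`IsStableSubordinator.map_inverseProcess`). Integrating the Laplace transform against `θ ^ (q - 1)`
yields the negative moments of `S 1`, hence `E[U(τ) ^ n] = τ ^ (β n) * n! / Γ(β n + 1)`. The
exponential series then gives `E[exp (z U(τ))] = E_β(z τ ^ β)`, and `τ = t ^ (α / β)` turns `τ ^ β`
into `t ^ α`.

Given the independent clock, increments of `X` are centred Gaussian with variance equal to the
clock's increment. This gives the characteristic function of `X t`, and `E[(X t - X s) ^ 2]` is a
difference of mean clock times because the clock is monotone.

For `B`, the coefficients `(-θ, θ)` show that `B t - B s` has the law of `X (t - s)`, so its second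
moment is read off from `X`. For `0 < s < t` the strict inequality `s ^ α + (t - s) ^ α < t ^ α`,
where `α > 1` enters, separates the second moments and therefore the joint laws. -/

/-! ### Growth of Gamma and convergence of the Mittag-Leffler series. -/

/-- Keep only the part `y > R` of the Gamma integral, where `y ^ (x - 1) ≥ R ^ (x - 1)`. -/
lemma rpow_mul_exp_neg_le_Gamma {R x : ℝ} (hR : 0 < R) (hx : 1 ≤ x) :
    R ^ (x - 1) * Real.exp (-R) ≤ Real.Gamma x := by
  have hx0 : 0 < x := by linarith
  have hint := Real.GammaIntegral_convergent hx0
  have hexp : IntegrableOn (fun y : ℝ => Real.exp (-y)) (Set.Ioi R) := by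
    simpa using integrableOn_exp_neg_Ioi R
  rw [Real.Gamma_eq_integral hx0]
  calc R ^ (x - 1) * Real.exp (-R)
      = ∫ y in Set.Ioi R, R ^ (x - 1) * Real.exp (-y) := by
        rw [integral_const_mul, integral_exp_neg_Ioi]
    _ ≤ ∫ y in Set.Ioi R, Real.exp (-y) * y ^ (x - 1) := by
        refine setIntegral_mono_on (hexp.const_mul _)
          (hint.mono_set (Set.Ioi_subset_Ioi hR.le)) measurableSet_Ioi fun y hy => ?_
        rw [mul_comm]
        exact mul_le_mul_of_nonneg_left
          (Real.rpow_le_rpow hR.le (Set.mem_Ioi.1 hy).le (sub_nonneg.2 hx)) (Real.exp_pos _).le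
    _ ≤ ∫ y in Set.Ioi (0 : ℝ), Real.exp (-y) * y ^ (x - 1) := by
        refine setIntegral_mono_set hint ?_ (Set.Ioi_subset_Ioi hR.le).eventuallyLE
        filter_upwards [ae_restrict_mem measurableSet_Ioi] with y hy
        have : (0 : ℝ) < y := hy
        positivity

lemma Gamma_mul_nat_add_one_pos {β : ℝ} (hβ : 0 < β) (n : ℕ) : 0 < Real.Gamma (β * n + 1) :=
  Real.Gamma_pos_of_pos (by positivity)

/-- The Mittag-Leffler series converges absolutely. -/
lemma summable_pow_div_Gamma {β x : ℝ} (hβ : 0 < β) (hx : 0 ≤ x) :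
    Summable fun n : ℕ => x ^ n / Real.Gamma (β * n + 1) := by
  -- With `R ^ β = 2 * x + 1` the Gamma bound reads `Γ(β n + 1) ≥ (2 * x + 1) ^ n * exp (-R)`, so
  -- the series is dominated by `exp R * (1 / 2) ^ n`. The `+ 1` keeps `R` positive when `x = 0`.
  set R : ℝ := (2 * x + 1) ^ (1 / β)
  have hR : 0 < R := by positivity
  have hRβ : R ^ β = 2 * x + 1 := by
    rw [← Real.rpow_mul (by positivity), one_div_mul_cancel hβ.ne', Real.rpow_one]
  refine Summable.of_nonneg_of_le
    (fun n => div_nonneg (pow_nonneg hx _) (Gamma_mul_nat_add_one_pos hβ n).le) (fun n => ?_)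
    (summable_geometric_two.mul_right (Real.exp R))
  have h := rpow_mul_exp_neg_le_Gamma hR (x := β * n + 1) (by
    have : 0 ≤ β * n := by positivity
    linarith)
  rw [add_sub_cancel_right, Real.rpow_mul hR.le, hRβ, Real.rpow_natCast, Real.exp_neg] at h
  rw [div_le_iff₀ (Gamma_mul_nat_add_one_pos hβ n)]
  calc x ^ n ≤ (1 / 2) ^ n * (2 * x + 1) ^ n := by
        rw [← mul_pow]; gcongr; linarith
    _ = (1 / 2) ^ n * Real.exp R * ((2 * x + 1) ^ n * (Real.exp R)⁻¹) := by
        have := (Real.exp_pos R).ne'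
        field_simp
    _ ≤ _ := by gcongr

/-! ### Laplace transforms and moments of the one-sided stable law. -/

/-- Exponential moments as power series in the moments. -/
lemma hasSum_moments_integral_cexp {Ω : Type*} [MeasurableSpace Ω] {μ : Measure Ω} {Y : Ω → ℝ}
    (hY : ∀ n : ℕ, Integrable (fun ω => Y ω ^ n) μ) (hY0 : ∀ᵐ ω ∂μ, 0 ≤ Y ω) (z : ℂ)
    (hs : Summable fun n : ℕ => ‖z‖ ^ n / n.factorial * ∫ ω, Y ω ^ n ∂μ) :
    HasSum (fun n : ℕ => z ^ n / n.factorial * ((∫ ω, Y ω ^ n ∂μ : ℝ) : ℂ))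
      (∫ ω, Complex.exp (z * Y ω) ∂μ) := by
  have key := hasSum_integral_of_summable_integral_norm (μ := μ)
    (F := fun (n : ℕ) ω => z ^ n / n.factorial * ((Y ω ^ n : ℝ) : ℂ))
    (fun n => (hY n).ofReal.const_mul _) (by
      convert hs using 2 with n
      rw [← integral_const_mul]
      refine integral_congr_ae ?_
      filter_upwards [hY0] with ω hω
      simp [abs_of_nonneg hω])
  simp only [integral_const_mul, integral_complex_ofReal] at key
  have hexp : ∀ ω, Complex.exp (z * Y ω) =
      ∑' n : ℕ, z ^ n / n.factorial * ((Y ω ^ n : ℝ) : ℂ) := fun ω => by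
    rw [Complex.exp_eq_exp_ℂ, NormedSpace.exp_eq_tsum_div]
    refine tsum_congr fun n => ?_
    push_cast
    ring
  simpa only [hexp] using key

/-- A probability measure on `[0, ∞)` is determined by its Laplace transform. -/
lemma ext_of_laplace {μ ν : Measure ℝ} [IsProbabilityMeasure μ] [IsProbabilityMeasure ν]
    (hμ : ∀ᵐ x ∂μ, 0 ≤ x) (hν : ∀ᵐ x ∂ν, 0 ≤ x)
    (h : ∀ θ : ℝ, 0 < θ → ∫ x, Real.exp (-θ * x) ∂μ = ∫ x, Real.exp (-θ * x) ∂ν) : μ = ν := by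
  -- `e` sends `[0, ∞)` into `(0, 1]`, and the Laplace transform at the integers gives the moments
  -- of the image law. Bounded moments determine its characteristic function, and `-log` undoes `e`.
  set e : ℝ → ℝ := fun x => Real.exp (-x)
  have he : Measurable e := by fun_prop
  have hmom : ∀ n : ℕ, ∫ x, e x ^ n ∂μ = ∫ x, e x ^ n ∂ν := by
    intro n
    rcases Nat.eq_zero_or_pos n with rfl | hn
    · simp
    · simpa [e, ← Real.exp_nat_mul] using h n (by positivity)
  have hb : ∀ ρ : Measure ℝ, [IsProbabilityMeasure ρ] → (∀ᵐ x ∂ρ, 0 ≤ x) → ∀ n : ℕ,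
      Integrable (fun x => e x ^ n) ρ ∧ 0 ≤ ∫ x, e x ^ n ∂ρ ∧ ∫ x, e x ^ n ∂ρ ≤ 1 := by
    intro ρ _ hρ n
    have hle : ∀ᵐ x ∂ρ, e x ^ n ≤ 1 := by
      filter_upwards [hρ] with x hx
      exact pow_le_one₀ (by positivity) (by simpa [e] using hx)
    have hi : Integrable (fun x => e x ^ n) ρ := by
      refine Integrable.of_bound (by fun_prop) 1 ?_
      filter_upwards [hle] with x hx
      rwa [Real.norm_of_nonneg (by positivity)]
    refine ⟨hi, integral_nonneg fun x => by positivity, ?_⟩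
    simpa using integral_mono_ae hi (integrable_const (1 : ℝ)) hle
  have hsum : ∀ ρ : Measure ℝ, [IsProbabilityMeasure ρ] → (∀ᵐ x ∂ρ, 0 ≤ x) → ∀ z : ℂ,
      HasSum (fun n : ℕ => z ^ n / n.factorial * ((∫ x, e x ^ n ∂ρ : ℝ) : ℂ))
        (∫ x, Complex.exp (z * e x) ∂ρ) := by
    intro ρ _ hρ z
    refine hasSum_moments_integral_cexp (fun n => (hb ρ hρ n).1)
      (ae_of_all _ fun x => by positivity) z ?_
    refine Summable.of_nonneg_of_le (fun n => mul_nonneg (by positivity) (hb ρ hρ n).2.1)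
      (fun n => mul_le_of_le_one_right (by positivity) (hb ρ hρ n).2.2)
      (Real.summable_pow_div_factorial ‖z‖)
  have hmap : μ.map e = ν.map e := by
    have := Measure.isProbabilityMeasure_map (μ := μ) he.aemeasurable
    have := Measure.isProbabilityMeasure_map (μ := ν) he.aemeasurable
    refine Measure.ext_of_charFun ?_
    ext t
    rw [charFun_apply_real, charFun_apply_real, integral_map he.aemeasurable (by fun_prop),
      integral_map he.aemeasurable (by fun_prop)]
    have h1 := hsum μ hμ (t * Complex.I)
    have h2 := hsum ν hν (t * Complex.I)
    simp only [hmom] at h1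
    have := h1.unique h2
    simpa only [mul_right_comm] using this
  have hlog : Measurable fun y : ℝ => -Real.log y := Real.measurable_log.neg
  have hcomp : (fun y : ℝ => -Real.log y) ∘ e = id := by ext x; simp [e]
  have := congrArg (Measure.map fun y : ℝ => -Real.log y) hmap
  rwa [Measure.map_map hlog he, Measure.map_map hlog he, hcomp, Measure.map_id,
    Measure.map_id] at this

/-- Negative moments of the one-sided stable law. -/
lemma lintegral_rpow_neg_of_laplace {β : ℝ} (hβ : 0 < β) {μ : Measure ℝ} [IsProbabilityMeasure μ]
    (hμ : ∀ᵐ x ∂μ, 0 < x) (h : ∀ θ : ℝ, 0 < θ → ∫ x, Real.exp (-θ * x) ∂μ = Real.exp (-θ ^ β))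
    {q : ℝ} (hq : 0 < q) :
    ∫⁻ x, ENNReal.ofReal (x ^ (-q)) ∂μ =
      ENNReal.ofReal (Real.Gamma (q / β) / (β * Real.Gamma q)) := by
  have hΓ : 0 < Real.Gamma q := Real.Gamma_pos_of_pos hq
  have hmul : ENNReal.ofReal (Real.Gamma q) * ∫⁻ x, ENNReal.ofReal (x ^ (-q)) ∂μ =
      ENNReal.ofReal (1 / β * Real.Gamma (q / β)) := by
    calc ENNReal.ofReal (Real.Gamma q) * ∫⁻ x, ENNReal.ofReal (x ^ (-q)) ∂μ
        = ∫⁻ x, (∫⁻ θ in Set.Ioi (0 : ℝ),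
            ENNReal.ofReal (θ ^ (q - 1) * Real.exp (-(x * θ)))) ∂μ := by
          rw [← lintegral_const_mul _ (by fun_prop)]
          refine lintegral_congr_ae ?_
          filter_upwards [hμ] with x hx
          have hI := Real.integral_rpow_mul_exp_neg_mul_Ioi hq hx
          -- A Bochner integral with nonzero value forces integrability.
          rw [← ofReal_integral_eq_lintegral_ofReal
            (Integrable.of_integral_ne_zero (by rw [hI]; positivity)), hI,
            ← ENNReal.ofReal_mul hΓ.le, one_div, Real.inv_rpow hx.le, Real.rpow_neg hx.le, mul_comm]
          filter_upwards [ae_restrict_mem measurableSet_Ioi] with θ hθ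
          have : (0 : ℝ) < θ := hθ
          positivity
      _ = ∫⁻ θ in Set.Ioi (0 : ℝ), (∫⁻ x,
            ENNReal.ofReal (θ ^ (q - 1) * Real.exp (-(x * θ))) ∂μ) := by
          refine lintegral_lintegral_swap (Measurable.aemeasurable ?_)
          fun_prop
      _ = ∫⁻ θ in Set.Ioi (0 : ℝ), ENNReal.ofReal (θ ^ (q - 1) * Real.exp (-θ ^ β)) := by
          refine setLIntegral_congr_fun measurableSet_Ioi fun θ hθ => ?_
          have hθ' : (0 : ℝ) < θ := hθ
          have hI := h θ hθ'
          rw [← hI, ← integral_const_mul, ofReal_integral_eq_lintegral_ofReal]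
          · simp only [neg_mul, mul_comm θ]
          · exact (Integrable.of_integral_ne_zero (by rw [hI]; positivity)).const_mul _
          · exact ae_of_all _ fun x => by positivity
      _ = ENNReal.ofReal (1 / β * Real.Gamma (q / β)) := by
          have hI := integral_rpow_mul_exp_neg_rpow (p := β) (q := q - 1) hβ (by linarith)
          rw [sub_add_cancel] at hI
          have hΓ' : 0 < Real.Gamma (q / β) := Real.Gamma_pos_of_pos (by positivity)
          rw [← hI, ofReal_integral_eq_lintegral_ofReal
            (Integrable.of_integral_ne_zero (by rw [hI]; positivity))]
          filter_upwards [ae_restrict_mem measurableSet_Ioi] with θ hθ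
          have : (0 : ℝ) < θ := hθ
          positivity
  rw [div_mul_eq_div_div, ENNReal.ofReal_div_of_pos hΓ]
  rw [ENNReal.eq_div_iff (by simpa using hΓ) (by simp), hmul]
  congr 1
  ring

/-- Moments of `(τ / x) ^ β` when `x` has the one-sided `β`-stable law. -/
lemma integral_div_rpow_pow_of_laplace {β : ℝ} (hβ : 0 < β) {μ : Measure ℝ}
    [IsProbabilityMeasure μ] (hμ : ∀ᵐ x ∂μ, 0 < x)
    (h : ∀ θ : ℝ, 0 < θ → ∫ x, Real.exp (-θ * x) ∂μ = Real.exp (-θ ^ β))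
    {τ : ℝ} (hτ : 0 ≤ τ) (n : ℕ) :
    Integrable (fun x => ((τ / x) ^ β) ^ n) μ ∧
      ∫ x, ((τ / x) ^ β) ^ n ∂μ = (τ ^ β) ^ n * (n.factorial / Real.Gamma (β * n + 1)) := by
  -- The negative-moment formula with `q = β * n` needs `q > 0`.
  rcases Nat.eq_zero_or_pos n with rfl | hn
  · simp
  have hn' : (0 : ℝ) < n := by exact_mod_cast hn
  have hq : 0 < β * n := by positivity
  have hΓ : 0 < Real.Gamma (β * n) := Real.Gamma_pos_of_pos hq
  have hL := lintegral_rpow_neg_of_laplace hβ hμ h hq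
  have hval : Real.Gamma (β * n / β) / (β * Real.Gamma (β * n)) =
      n.factorial / Real.Gamma (β * n + 1) := by
    rw [mul_div_cancel_left₀ _ hβ.ne', Real.Gamma_add_one hq.ne']
    have : (n.factorial : ℝ) = n * Real.Gamma n := by
      rw [← Real.Gamma_add_one hn'.ne', Real.Gamma_nat_eq_factorial]
    rw [this]
    field_simp
  rw [hval] at hL
  have hnn : 0 ≤ᵐ[μ] fun x : ℝ => x ^ (-(β * n)) := by
    filter_upwards [hμ] with x hx
    positivity
  have hc : (0 : ℝ) ≤ n.factorial / Real.Gamma (β * n + 1) :=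
    div_nonneg (by positivity) (Gamma_mul_nat_add_one_pos hβ n).le
  have hint : Integrable (fun x : ℝ => x ^ (-(β * n))) μ := by
    refine ⟨by fun_prop, ?_⟩
    rw [hasFiniteIntegral_iff_ofReal hnn, hL]
    exact ENNReal.ofReal_lt_top
  have heq : (fun x : ℝ => ((τ / x) ^ β) ^ n) =ᵐ[μ] fun x => (τ ^ β) ^ n * x ^ (-(β * n)) := by
    filter_upwards [hμ] with x hx
    rw [Real.div_rpow hτ hx.le, div_pow, Real.rpow_neg hx.le, Real.rpow_mul hx.le,
      Real.rpow_natCast, div_eq_mul_inv]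
  refine ⟨(hint.const_mul _).congr heq.symm, ?_⟩
  rw [integral_congr_ae heq, integral_const_mul,
    integral_eq_lintegral_of_nonneg_ae hnn (by fun_prop), hL, ENNReal.toReal_ofReal hc]

/-- The `n!` in the moments cancels the `n!` of the exponential series, leaving the Mittag-Leffler
coefficients. -/
lemma integral_cexp_div_rpow_of_laplace {β : ℝ} (hβ : 0 < β) {μ : Measure ℝ}
    [IsProbabilityMeasure μ] (hμ : ∀ᵐ x ∂μ, 0 < x)
    (h : ∀ θ : ℝ, 0 < θ → ∫ x, Real.exp (-θ * x) ∂μ = Real.exp (-θ ^ β))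
    {τ : ℝ} (hτ : 0 ≤ τ) (z : ℂ) :
    ∫ x, Complex.exp (z * ((τ / x) ^ β : ℝ)) ∂μ = mittagLeffler β (z * (τ ^ β : ℝ)) := by
  have hm := integral_div_rpow_pow_of_laplace hβ hμ h hτ
  have hsum := hasSum_moments_integral_cexp (fun n => (hm n).1) (by
    filter_upwards [hμ] with x hx
    positivity) z (by
    refine (summable_pow_div_Gamma hβ (x := ‖z‖ * τ ^ β) (by positivity)).congr fun n => ?_
    rw [(hm n).2, mul_pow]
    have := n.factorial_ne_zero
    field_simp)
  rw [← hsum.tsum_eq, mittagLeffler]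
  congr 1 with n
  rw [(hm n).2]
  have : (n.factorial : ℂ) ≠ 0 := by exact_mod_cast n.factorial_ne_zero
  push_cast
  rw [mul_pow]
  field_simp

/-! ### First passage as a measurable functional of countably many coordinates. -/

/-- The first-passage functional on paths indexed by nonnegative rationals. -/
noncomputable def rationalFirstPassage (τ : ℝ≥0) (p : ℚ≥0 → ℝ) : ℝ≥0 :=
  open Classical in (⨅ q : ℚ≥0, if (τ : ℝ) < p q then ((q : ℝ≥0) : ENNReal) else ⊤).toNNReal

lemma measurable_rationalFirstPassage (τ : ℝ≥0) : Measurable (rationalFirstPassage τ) := by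
  classical
  unfold rationalFirstPassage
  refine ENNReal.measurable_toNNReal.comp (Measurable.iInf fun q => ?_)
  exact Measurable.ite (measurableSet_lt measurable_const (measurable_pi_apply q))
    measurable_const measurable_const

/-- For monotone `f` the passage set is closed upwards, so rationals just to the right of its points
suffice; no continuity of `f` is needed. -/
lemma rationalFirstPassage_eq_sInf (τ : ℝ≥0) {f : ℝ≥0 → ℝ} (hf : Monotone f) :
    rationalFirstPassage τ (fun q => f q) = sInf {s : ℝ≥0 | (τ : ℝ) < f s} := by
  classical
  rcases Set.eq_empty_or_nonempty {s : ℝ≥0 | (τ : ℝ) < f s} with hA | hA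
  -- If the level is never passed, both sides take the default `0`: `⊤.toNNReal` and `sInf ∅`.
  · have : ∀ s, ¬ (τ : ℝ) < f s := fun s hs => Set.eq_empty_iff_forall_notMem.1 hA s hs
    simp [rationalFirstPassage, this]
  · suffices (⨅ q : ℚ≥0, if (τ : ℝ) < f q then ((q : ℝ≥0) : ENNReal) else ⊤) =
        ((sInf {s : ℝ≥0 | (τ : ℝ) < f s} : ℝ≥0) : ENNReal) by
      rw [rationalFirstPassage, this, ENNReal.toNNReal_coe]
    refine le_antisymm (le_of_forall_gt fun c hc => ?_) (le_iInf fun q => ?_)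
    · obtain ⟨d, hd, hdc⟩ := ENNReal.lt_iff_exists_nnreal_btwn.1 hc
      obtain ⟨a, ha, had⟩ := exists_lt_of_csInf_lt hA (ENNReal.coe_lt_coe.1 hd)
      obtain ⟨r, hr, haq, hqd⟩ := (NNReal.lt_iff_exists_rat_btwn _ _).1 had
      lift r to ℚ≥0 using hr with q
      have hqr : Real.toNNReal ((q : ℚ) : ℝ) = q := by
        ext
        rw [Real.coe_toNNReal _ (by positivity), Rat.cast_nnratCast]
        rfl
      rw [hqr] at haq hqd
      have hq : (τ : ℝ) < f q := lt_of_lt_of_le ha (hf haq.le)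
      refine lt_of_le_of_lt (iInf_le _ q) ?_
      rw [if_pos hq]
      exact (ENNReal.coe_lt_coe.2 hqd).trans hdc
    · split_ifs with hq
      · exact ENNReal.coe_le_coe.2 (csInf_le (OrderBot.bddBelow _) hq)
      · exact le_top

/-- Continuity from below. The events increase only up to null sets, so each is compared with its
accumulated union. -/
lemma measure_exists_eq_iSup_of_ae_monotone {Ω : Type*} [MeasurableSpace Ω] {P : Measure Ω}
    {p : ℕ → Ω → Prop} (h : ∀ᵐ ω ∂P, Monotone fun n => p n ω) :
    P {ω | ∃ n, p n ω} = ⨆ n, P {ω | p n ω} := by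
  rw [Set.ofPred_exists, measure_iUnion_eq_iSup_accumulate]
  refine iSup_congr fun n => measure_congr ?_
  filter_upwards [h] with ω hω
  refine propext ⟨fun hn => ?_, fun hn => Set.mem_accumulate.2 ⟨n, le_rfl, hn⟩⟩
  obtain ⟨k, hk, hpk⟩ := Set.mem_accumulate.1 hn
  exact hω hk hpk

/-! ### The stable subordinator and the law of its inverse. -/

section Subordinator

variable {Ω : Type*} [MeasurableSpace Ω] {P : Measure Ω} {β : ℝ} {S : ℝ≥0 → Ω → ℝ}

lemma IsStableSubordinator.ae_pos (hS : IsStableSubordinator β S P) :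
    ∀ᵐ ω ∂P, ∀ t : ℝ≥0, 0 < t → 0 < S t ω := by
  filter_upwards [hS.start_zero, hS.strictMono_paths] with ω h0 hm t ht
  simpa [h0] using hm ht

lemma IsStableSubordinator.ae_nonneg (hS : IsStableSubordinator β S P) :
    ∀ᵐ ω ∂P, ∀ t : ℝ≥0, 0 ≤ S t ω := by
  filter_upwards [hS.start_zero, hS.strictMono_paths] with ω h0 hm t
  simpa [h0] using hm.monotone (zero_le)

/-- The law of `S 1` is carried by `(0, ∞)` and has Laplace transform `exp (-θ ^ β)`. -/
lemma IsStableSubordinator.law_one [IsProbabilityMeasure P] (hS : IsStableSubordinator β S P) :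
    IsProbabilityMeasure (P.map (S 1)) ∧ (∀ᵐ x ∂(P.map (S 1)), 0 < x) ∧
      ∀ θ : ℝ, 0 < θ → ∫ x, Real.exp (-θ * x) ∂(P.map (S 1)) = Real.exp (-θ ^ β) := by
  refine ⟨Measure.isProbabilityMeasure_map (hS.aemeasurable 1), ?_, fun θ hθ => ?_⟩
  · rw [ae_map_iff (hS.aemeasurable 1) measurableSet_Ioi]
    filter_upwards [hS.ae_pos] with ω hω using hω 1 one_pos
  · rw [integral_map (hS.aemeasurable 1) (by fun_prop), hS.laplace_eq 1 θ hθ]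
    simp

/-- Self-similarity of the stable subordinator at a fixed time. -/
lemma IsStableSubordinator.map_eq [IsProbabilityMeasure P] (hβ : 0 < β)
    (hS : IsStableSubordinator β S P) (s : ℝ≥0) :
    P.map (S s) = P.map (fun ω => (s : ℝ) ^ (1 / β) * S 1 ω) := by
  have hm : AEMeasurable (fun ω => (s : ℝ) ^ (1 / β) * S 1 ω) P :=
    (hS.aemeasurable 1).const_mul _
  have := Measure.isProbabilityMeasure_map (hS.aemeasurable s)
  have := Measure.isProbabilityMeasure_map hm
  refine ext_of_laplace ?_ ?_ fun θ hθ => ?_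
  · rw [ae_map_iff (hS.aemeasurable s) measurableSet_Ici]
    filter_upwards [hS.ae_nonneg] with ω hω using hω s
  · rw [ae_map_iff hm measurableSet_Ici]
    filter_upwards [hS.ae_nonneg] with ω hω using mul_nonneg (by positivity) (hω 1)
  · rw [integral_map (hS.aemeasurable s) (by fun_prop), integral_map hm (by fun_prop),
      hS.laplace_eq s θ hθ]
    -- The scaled argument `θ * s ^ (1 / β)` must be positive to use `laplace_eq`, so `s = 0` is
    -- separate.
    rcases eq_or_lt_of_le (zero_le (a := s)) with rfl | hs
    · simp [hβ.ne']
    · have hs' : (0 : ℝ) < s := hs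
      have h := hS.laplace_eq 1 (θ * (s : ℝ) ^ (1 / β)) (by positivity)
      rw [Real.mul_rpow hθ.le (by positivity), ← Real.rpow_mul hs'.le,
        one_div_mul_cancel hβ.ne', Real.rpow_one] at h
      calc Real.exp (-(s : ℝ) * θ ^ β) = Real.exp (-((1 : ℝ≥0) : ℝ) * (θ ^ β * s)) := by
            congr 1; push_cast; ring
        _ = _ := by
            rw [← h]
            congr 1 with ω
            congr 1; ring

lemma IsStableSubordinator.ae_exists_lt [IsProbabilityMeasure P]
    (hS : IsStableSubordinator β S P) :
    ∀ᵐ ω ∂P, ∀ τ : ℝ≥0, ∃ s : ℝ≥0, (τ : ℝ) < S s ω := by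
  have hnat : ∀ m : ℕ, ∀ᵐ ω ∂P, ∃ n : ℕ, (m : ℝ) < S n ω := by
    intro m
    -- Markov's inequality for `exp (-S n)`: staying below `m` forever has probability at most `exp
    -- (m - n)` for every `n`.
    have hle : ∀ n : ℕ, P {ω | ∀ k : ℕ, S k ω ≤ m} ≤ ENNReal.ofReal (Real.exp (m - n)) := by
      intro n
      have hmk : ∫⁻ ω, ENNReal.ofReal (Real.exp (m) * Real.exp (-1 * S n ω)) ∂P =
          ENNReal.ofReal (Real.exp (m - n)) := by
        have hL := hS.laplace_eq n 1 one_pos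
        rw [← ofReal_integral_eq_lintegral_ofReal
          ((Integrable.of_integral_ne_zero (by rw [hL]; positivity)).const_mul _)
          (ae_of_all _ fun ω => by positivity), integral_const_mul, hL, ← Real.exp_add]
        congr 2
        simp [sub_eq_add_neg]
      rw [← hmk]
      calc P {ω | ∀ k : ℕ, S k ω ≤ m}
          ≤ ∫⁻ ω in {ω | ∀ k : ℕ, S k ω ≤ m}, 1 ∂P := by simp
        _ ≤ ∫⁻ ω in {ω | ∀ k : ℕ, S k ω ≤ m},
              ENNReal.ofReal (Real.exp (m) * Real.exp (-1 * S n ω)) ∂P := by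
            refine setLIntegral_mono_ae (by
              have := hS.aemeasurable n
              fun_prop) (ae_of_all _ fun ω hω => ?_)
            rw [← Real.exp_add, ENNReal.one_le_ofReal, Real.one_le_exp_iff]
            have : S n ω ≤ m := hω n
            linarith
        _ ≤ _ := setLIntegral_le_lintegral _ _
    have hlim : Filter.Tendsto (fun n : ℕ => ENNReal.ofReal (Real.exp (m - n))) Filter.atTop
        (nhds 0) := by
      rw [← ENNReal.ofReal_zero]
      refine (ENNReal.continuous_ofReal.tendsto _).comp (Real.tendsto_exp_atBot.comp ?_)
      exact Filter.tendsto_atBot_add_const_left _ _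
        (Filter.tendsto_neg_atTop_atBot.comp tendsto_natCast_atTop_atTop)
    have h0 : P {ω | ∀ k : ℕ, S k ω ≤ m} = 0 :=
      le_antisymm (ge_of_tendsto' hlim hle) (zero_le)
    rw [ae_iff]
    simpa using h0
  filter_upwards [ae_all_iff.2 hnat] with ω hω τ
  obtain ⟨m, hm⟩ := exists_nat_ge (τ : ℝ)
  obtain ⟨n, hn⟩ := hω m
  exact ⟨n, hm.trans_lt hn⟩

lemma IsStableSubordinator.inverseProcess_ae_eq (hS : IsStableSubordinator β S P) (τ : ℝ≥0) :
    inverseProcess S τ =ᵐ[P] fun ω => rationalFirstPassage τ (fun q => S q ω) := by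
  filter_upwards [hS.strictMono_paths] with ω hω
  exact (rationalFirstPassage_eq_sInf τ hω.monotone).symm

lemma IsStableSubordinator.aemeasurable_inverseProcess (hS : IsStableSubordinator β S P)
    (τ : ℝ≥0) : AEMeasurable (inverseProcess S τ) P := by
  refine AEMeasurable.congr ?_ (hS.inverseProcess_ae_eq τ).symm
  exact (measurable_rationalFirstPassage τ).comp_aemeasurable
    (aemeasurable_pi_lambda _ fun q => hS.aemeasurable q)

/-- Unboundedness of the paths matters here: an empty passage set would make the infimum drop to
`0`. -/
lemma IsStableSubordinator.inverseProcess_mono [IsProbabilityMeasure P]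
    (hS : IsStableSubordinator β S P) :
    ∀ᵐ ω ∂P, Monotone fun τ => inverseProcess S τ ω := by
  filter_upwards [hS.ae_exists_lt] with ω hω σ τ hστ
  exact csInf_le_csInf (OrderBot.bddBelow _) (hω τ) fun s hs =>
    lt_of_le_of_lt (NNReal.coe_le_coe.2 hστ) hs

/-- `S a ω ≤ τ` alone only gives `a ≤ U(τ)`. The shifts `1 / (n + 1)` restore strictness without
using right-continuity. -/
lemma lt_inverseProcess_iff {Ω : Type*} {S : ℝ≥0 → Ω → ℝ} {ω : Ω} (hm : StrictMono fun t => S t ω) {τ : ℝ≥0}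
    (hne : ∃ s : ℝ≥0, (τ : ℝ) < S s ω) (a : ℝ≥0) :
    a < inverseProcess S τ ω ↔ ∃ n : ℕ, S (a + 1 / ((n : ℝ≥0) + 1)) ω ≤ τ := by
  constructor
  · intro h
    obtain ⟨n, hn⟩ := exists_nat_one_div_lt (tsub_pos_of_lt h)
    refine ⟨n, not_lt.1 fun hlt => ?_⟩
    have h1 : inverseProcess S τ ω ≤ a + 1 / ((n : ℝ≥0) + 1) :=
      csInf_le (OrderBot.bddBelow _) hlt
    exact absurd (lt_tsub_iff_left.1 hn) (not_lt.2 h1)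
  · rintro ⟨n, hn⟩
    have h1 : a < a + 1 / ((n : ℝ≥0) + 1) := lt_add_of_pos_right _ (by positivity)
    refine h1.trans_le (le_csInf hne fun s hs => ?_)
    exact (hm.lt_iff_lt.1 (lt_of_le_of_lt hn hs)).le

/-- The law of the inverse subordinator. -/
lemma IsStableSubordinator.map_inverseProcess [IsProbabilityMeasure P] (hβ : 0 < β)
    (hS : IsStableSubordinator β S P) (τ : ℝ≥0) :
    P.map (fun ω => (inverseProcess S τ ω : ℝ)) =
      (P.map (S 1)).map (fun x => ((τ : ℝ) / x) ^ β) := by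
  have hU : AEMeasurable (fun ω => (inverseProcess S τ ω : ℝ)) P :=
    measurable_coe_nnreal_real.comp_aemeasurable (hS.aemeasurable_inverseProcess τ)
  have hg : Measurable fun x : ℝ => ((τ : ℝ) / x) ^ β := by fun_prop
  have hV : AEMeasurable (fun ω => ((τ : ℝ) / S 1 ω) ^ β) P :=
    hg.comp_aemeasurable (hS.aemeasurable 1)
  rw [AEMeasurable.map_map_of_aemeasurable hg.aemeasurable (hS.aemeasurable 1)]
  change _ = P.map (fun ω => ((τ : ℝ) / S 1 ω) ^ β)
  have := Measure.isProbabilityMeasure_map hU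
  have := Measure.isProbabilityMeasure_map hV
  have key : ∀ a : ℝ, P.map (fun ω => (inverseProcess S τ ω : ℝ)) (Set.Ioi a) =
      P.map (fun ω => ((τ : ℝ) / S 1 ω) ^ β) (Set.Ioi a) := by
    intro a
    rw [Measure.map_apply_of_aemeasurable hU measurableSet_Ioi,
      Measure.map_apply_of_aemeasurable hV measurableSet_Ioi]
    rcases lt_or_ge a 0 with ha | ha
    · refine measure_congr ?_
      filter_upwards [hS.ae_nonneg] with ω hω
      have h1 : a < (inverseProcess S τ ω : ℝ) := ha.trans_le (NNReal.coe_nonneg _)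
      have h2 : a < ((τ : ℝ) / S 1 ω) ^ β :=
        ha.trans_le (Real.rpow_nonneg (div_nonneg τ.2 (hω 1)) _)
      exact propext (iff_of_true h1 h2)
    lift a to ℝ≥0 using ha
    set r : ℕ → ℝ≥0 := fun n => a + 1 / ((n : ℝ≥0) + 1)
    have hanti : Antitone r := fun m n hmn => by
      have : (m : ℝ≥0) ≤ n := by exact_mod_cast hmn
      simp only [r]
      gcongr
    -- Self-similarity holds in law at each fixed time only, so it is applied event by event;
    -- monotone limits then carry it to the union over `n`.
    have hscale : ∀ n, P {ω | S (r n) ω ≤ τ} = P {ω | (r n : ℝ) ^ (1 / β) * S 1 ω ≤ τ} := by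
      intro n
      have h : P.map _ (Set.Iic (τ : ℝ)) = P.map _ (Set.Iic (τ : ℝ)) :=
        DFunLike.congr_fun (hS.map_eq hβ (r n)) _
      rwa [Measure.map_apply_of_aemeasurable (hS.aemeasurable _) measurableSet_Iic,
        Measure.map_apply_of_aemeasurable ((hS.aemeasurable 1).const_mul _)
          measurableSet_Iic] at h
    have hle : ∀ᵐ ω ∂P, ∀ n,
        (r n : ℝ) ^ (1 / β) * S 1 ω ≤ τ ↔ (r n : ℝ) ≤ ((τ : ℝ) / S 1 ω) ^ β := by
      filter_upwards [hS.ae_pos] with ω hω n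
      rw [← le_div_iff₀ (hω 1 one_pos), one_div]
      exact (Real.rpow_inv_le_iff_of_pos (NNReal.coe_nonneg _) (div_nonneg τ.2 (hω 1 one_pos).le) hβ)
    have hmono1 : ∀ᵐ ω ∂P, Monotone fun n => S (r n) ω ≤ τ := by
      filter_upwards [hS.strictMono_paths] with ω hω m n hmn h
      exact (hω.monotone (hanti hmn)).trans h
    have hmono2 : ∀ᵐ ω ∂P, Monotone fun n => (r n : ℝ) ^ (1 / β) * S 1 ω ≤ τ := by
      filter_upwards [hle] with ω hω m n hmn h
      exact (hω n).2 ((NNReal.coe_le_coe.2 (hanti hmn)).trans ((hω m).1 h))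
    calc P ((fun ω => (inverseProcess S τ ω : ℝ)) ⁻¹' Set.Ioi a)
        = P {ω | ∃ n, S (r n) ω ≤ τ} := by
          refine measure_congr ?_
          filter_upwards [hS.strictMono_paths, hS.ae_exists_lt] with ω hm hne
          exact propext (NNReal.coe_lt_coe.trans (lt_inverseProcess_iff hm (hne τ) a))
      _ = P {ω | ∃ n, (r n : ℝ) ^ (1 / β) * S 1 ω ≤ τ} := by
          rw [measure_exists_eq_iSup_of_ae_monotone hmono1,
            measure_exists_eq_iSup_of_ae_monotone hmono2]
          exact iSup_congr hscale
      _ = P ((fun ω => ((τ : ℝ) / S 1 ω) ^ β) ⁻¹' Set.Ioi a) := by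
          refine measure_congr ?_
          filter_upwards [hle] with ω hω
          refine propext ⟨fun ⟨n, hn⟩ => ?_, fun h => ?_⟩
          · refine lt_of_lt_of_le (NNReal.coe_lt_coe.2 ?_) ((hω n).1 hn)
            exact lt_add_of_pos_right _ (by positivity)
          · have h' : (a : ℝ) < ((τ : ℝ) / S 1 ω) ^ β := h
            obtain ⟨n, hn⟩ := exists_nat_one_div_lt (sub_pos.2 h')
            refine ⟨n, (hω n).2 ?_⟩
            simp only [r]
            push_cast
            linarith
  refine Measure.ext_of_Iic _ _ fun a => ?_
  have h := key a
  rw [← Set.compl_Iic, prob_compl_eq_one_sub measurableSet_Iic,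
    prob_compl_eq_one_sub measurableSet_Iic] at h
  exact (ENNReal.sub_right_inj ENNReal.one_ne_top prob_le_one prob_le_one).1 h

end Subordinator

/-! ### Jointly measurable evaluation of continuous paths. -/

/-- Evaluation at time `u` of a continuous path known on the grids `ℕ / k`. -/
@[irreducible] noncomputable def gridEval (p : ℕ × ℕ → ℝ) (u : ℝ≥0) : ℝ :=
  Filter.limsup (fun k : ℕ => p (k, ⌊(u : ℝ) * k⌋₊)) Filter.atTop

-- Evaluation `(p, u) ↦ p u` is not jointly measurable for the product σ-algebra over all times.
-- With countably many grid coordinates it is a `limsup` of measurable maps.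
@[fun_prop]
lemma measurable_gridEval : Measurable fun x : (ℕ × ℕ → ℝ) × ℝ≥0 => gridEval x.1 x.2 := by
  unfold gridEval
  refine Measurable.limsup fun k => ?_
  have h : Measurable fun y : (ℕ × ℕ → ℝ) × ℕ => y.1 (k, y.2) :=
    measurable_from_prod_countable_left fun j => measurable_pi_apply (k, j)
  exact h.comp (measurable_fst.prodMk (Nat.measurable_floor.comp (by fun_prop)))

lemma gridEval_eq {f : ℝ≥0 → ℝ} (hf : Continuous f) (u : ℝ≥0) :
    gridEval (fun q => f ((q.2 : ℝ≥0) / q.1)) u = f u := by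
  unfold gridEval
  refine Filter.Tendsto.limsup_eq ((hf.tendsto u).comp ?_)
  rw [← NNReal.tendsto_coe]
  refine ((tendsto_nat_floor_mul_div_atTop u.2).comp
    (tendsto_natCast_atTop_atTop (R := ℝ))).congr fun k => ?_
  simp

/-- The increment between two times of a continuous path known on the grids `ℕ / k`. -/
@[irreducible] noncomputable def gridIncrement (x : (ℕ × ℕ → ℝ) × (ℝ≥0 × ℝ≥0)) : ℝ :=
  gridEval x.1 x.2.1 - gridEval x.1 x.2.2

@[fun_prop]
lemma measurable_gridIncrement : Measurable gridIncrement := by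
  have h1 := measurable_gridEval.comp
    (by fun_prop : Measurable fun x : (ℕ × ℕ → ℝ) × (ℝ≥0 × ℝ≥0) => (x.1, x.2.1))
  have h2 := measurable_gridEval.comp
    (by fun_prop : Measurable fun x : (ℕ × ℕ → ℝ) × (ℝ≥0 × ℝ≥0) => (x.1, x.2.2))
  unfold gridIncrement
  exact h1.sub h2

/-- The values of a process on the grids `ℕ / k`. -/
noncomputable def gridPath {Ω : Type*} (W : ℝ≥0 → Ω → ℝ) (ω : Ω) (q : ℕ × ℕ) : ℝ :=
  W ((q.2 : ℝ≥0) / q.1) ω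

/-! ### Brownian motion at independent random times. -/

section TimeChange

variable {Ω : Type*} [MeasurableSpace Ω] {P : Measure Ω} {W : ℝ≥0 → Ω → ℝ} {U V : Ω → ℝ≥0}

lemma ProbabilityTheory.IsBrownianReal.gridIncrement_ae_eq (hW : IsBrownianReal W P) :
    ∀ᵐ ω ∂P, ∀ u v : ℝ≥0, gridIncrement (gridPath W ω, (u, v)) = W u ω - W v ω := by
  filter_upwards [hW.cont] with ω hω u v
  unfold gridIncrement gridPath
  rw [gridEval_eq (f := fun t => W t ω) hω, gridEval_eq (f := fun t => W t ω) hω]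

lemma ProbabilityTheory.IsBrownianReal.randomIncrement_ae_eq (hW : IsBrownianReal W P) :
    (fun ω => W (U ω) ω - W (V ω) ω) =ᵐ[P] fun ω => gridIncrement (gridPath W ω, (U ω, V ω)) := by
  filter_upwards [hW.gridIncrement_ae_eq] with ω hω using (hω _ _).symm

lemma ProbabilityTheory.IsBrownianReal.aemeasurable_gridPath (hW : IsBrownianReal W P) :
    AEMeasurable (gridPath W) P :=
  aemeasurable_pi_lambda _ fun _ => hW.aemeasurable _

lemma ProbabilityTheory.IsBrownianReal.aemeasurable_randomIncrement (hW : IsBrownianReal W P)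
    (hU : AEMeasurable U P) (hV : AEMeasurable V P) :
    AEMeasurable (fun ω => W (U ω) ω - W (V ω) ω) P := by
  refine AEMeasurable.congr ?_ hW.randomIncrement_ae_eq.symm
  exact measurable_gridIncrement.comp_aemeasurable
    (hW.aemeasurable_gridPath.prodMk (hU.prodMk hV))

/-- The law of an increment of Brownian motion between independent random times. -/
lemma ProbabilityTheory.IsBrownianReal.map_randomIncrement [IsProbabilityMeasure P]
    (hW : IsBrownianReal W P) (hU : AEMeasurable U P) (hV : AEMeasurable V P)
    (hind : IndepFun (fun ω t => W t ω) (fun ω => (U ω, V ω)) P) :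
    P.map (fun ω => W (U ω) ω - W (V ω) ω) =
      ((P.map (gridPath W)).prod (P.map fun ω => (U ω, V ω))).map gridIncrement := by
  have hφ : Measurable fun (p : ℝ≥0 → ℝ) (q : ℕ × ℕ) => p ((q.2 : ℝ≥0) / q.1) := by fun_prop
  have hind' : IndepFun (gridPath W) (fun ω => (U ω, V ω)) P := hind.comp hφ measurable_id
  have hUV := hU.prodMk hV
  rw [← (indepFun_iff_map_prod_eq_prod_map_map hW.aemeasurable_gridPath hUV).1 hind',
    AEMeasurable.map_map_of_aemeasurable measurable_gridIncrement.aemeasurable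
      (hW.aemeasurable_gridPath.prodMk hUV)]
  exact Measure.map_congr hW.randomIncrement_ae_eq

lemma ProbabilityTheory.IsBrownianReal.map_gridIncrement (hW : IsBrownianReal W P) (u v : ℝ≥0) :
    (P.map (gridPath W)).map (fun p => gridIncrement (p, (u, v))) =
      gaussianReal 0 (nndist (u : ℝ) (v : ℝ)) := by
  rw [AEMeasurable.map_map_of_aemeasurable (by fun_prop) hW.aemeasurable_gridPath]
  refine Eq.trans (Measure.map_congr ?_) (hW.hasLaw_sub u v).map_eq
  filter_upwards [hW.gridIncrement_ae_eq] with ω hω using hω u v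

/-- Fubini on the product law: for frozen times the increment is Gaussian with variance `|u - v|`.
-/
lemma ProbabilityTheory.IsBrownianReal.charFun_randomIncrement [IsProbabilityMeasure P]
    (hW : IsBrownianReal W P) (hU : AEMeasurable U P) (hV : AEMeasurable V P)
    (hind : IndepFun (fun ω t => W t ω) (fun ω => (U ω, V ω)) P) (θ : ℝ) :
    charFun (P.map fun ω => W (U ω) ω - W (V ω) ω) θ =
      ∫ ω, Complex.exp ((-(θ ^ 2 / 2) : ℝ) * (nndist (U ω : ℝ) (V ω) : ℝ)) ∂P := by
  have hUV := hU.prodMk hV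
  have := Measure.isProbabilityMeasure_map hW.aemeasurable_gridPath
  have := Measure.isProbabilityMeasure_map hUV
  have hinner : ∀ y : ℝ≥0 × ℝ≥0,
      ∫ p, Complex.exp (θ * gridIncrement (p, y) * Complex.I) ∂(P.map (gridPath W)) =
        Complex.exp ((-(θ ^ 2 / 2) : ℝ) * (nndist (y.1 : ℝ) (y.2 : ℝ) : ℝ)) := by
    rintro ⟨u, v⟩
    have h := charFun_gaussianReal (μ := 0) (v := nndist (u : ℝ) v) θ
    rw [← hW.map_gridIncrement u v, charFun_apply_real,
      integral_map (by fun_prop) (by fun_prop)] at h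
    rw [h]
    congr 1
    push_cast
    ring
  rw [hW.map_randomIncrement hU hV hind, charFun_apply_real,
    integral_map measurable_gridIncrement.aemeasurable (by fun_prop), integral_prod_symm]
  · simp only [hinner]
    rw [integral_map hUV]
    fun_prop
  · refine Integrable.of_bound (C := 1) ?_ (ae_of_all _ fun x => ?_)
    · exact Measurable.aestronglyMeasurable (by fun_prop)
    · rw [← Complex.ofReal_mul, Complex.norm_exp_ofReal_mul_I]

lemma lintegral_sq_gaussianReal (v : ℝ≥0) :
    ∫⁻ x, ENNReal.ofReal (x ^ 2) ∂(gaussianReal 0 v) = v := by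
  have hm : Integrable (fun x : ℝ => x ^ 2) (gaussianReal 0 v) :=
    (memLp_id_gaussianReal 2).integrable_sq
  have h := variance_id_gaussianReal (μ := 0) (v := v)
  rw [variance_of_integral_eq_zero aemeasurable_id (by simp)] at h
  rw [← ofReal_integral_eq_lintegral_ofReal hm (ae_of_all _ fun x => sq_nonneg _)]
  simp only [id] at h
  rw [h, ENNReal.ofReal_coe_nnreal]

/-- The same conditioning by Tonelli; working with `∫⁻` lets square integrability be a consequence.
-/
lemma ProbabilityTheory.IsBrownianReal.lintegral_sq_randomIncrement [IsProbabilityMeasure P]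
    (hW : IsBrownianReal W P) (hU : AEMeasurable U P) (hV : AEMeasurable V P)
    (hind : IndepFun (fun ω t => W t ω) (fun ω => (U ω, V ω)) P) :
    ∫⁻ ω, ENNReal.ofReal ((W (U ω) ω - W (V ω) ω) ^ 2) ∂P =
      ∫⁻ ω, (nndist (U ω : ℝ) (V ω) : ENNReal) ∂P := by
  have hUV := hU.prodMk hV
  have := Measure.isProbabilityMeasure_map hW.aemeasurable_gridPath
  have := Measure.isProbabilityMeasure_map hUV
  have hf : Measurable fun x : ℝ => ENNReal.ofReal (x ^ 2) := by fun_prop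
  have hinner : ∀ y : ℝ≥0 × ℝ≥0,
      ∫⁻ p, ENNReal.ofReal (gridIncrement (p, y) ^ 2) ∂(P.map (gridPath W)) =
        (nndist (y.1 : ℝ) (y.2 : ℝ) : ENNReal) := by
    rintro ⟨u, v⟩
    have h := lintegral_sq_gaussianReal (nndist (u : ℝ) v)
    rwa [← hW.map_gridIncrement u v, lintegral_map hf (by fun_prop)] at h
  rw [← lintegral_map' hf.aemeasurable (hW.aemeasurable_randomIncrement hU hV),
    hW.map_randomIncrement hU hV hind, lintegral_map hf measurable_gridIncrement,
    lintegral_prod_symm _ (by fun_prop)]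
  simp only [hinner]
  rw [lintegral_map' (by fun_prop) hUV]

end TimeChange

/-! ### Marginals and increments of the time-changed process. -/

section TimeChangedProcess

variable {Ω : Type*} [MeasurableSpace Ω] {P : Measure Ω} {β α : ℝ} {W S : ℝ≥0 → Ω → ℝ}

lemma coe_rpow_div_rpow (hβ : 0 < β) (t : ℝ≥0) :
    ((t ^ (α / β) : ℝ≥0) : ℝ) ^ β = (t : ℝ) ^ α := by
  rw [NNReal.coe_rpow, ← Real.rpow_mul (NNReal.coe_nonneg t), div_mul_cancel₀ _ hβ.ne']

lemma IsStableSubordinator.aemeasurable_timeChange (hS : IsStableSubordinator β S P) (t : ℝ≥0) :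
    AEMeasurable (timeChange β α S t) P :=
  hS.aemeasurable_inverseProcess _

lemma IsStableSubordinator.integral_timeChange [IsProbabilityMeasure P] (hβ : 0 < β)
    (hS : IsStableSubordinator β S P) (t : ℝ≥0) :
    Integrable (fun ω => (timeChange β α S t ω : ℝ)) P ∧
      ∫ ω, (timeChange β α S t ω : ℝ) ∂P = (t : ℝ) ^ α / Real.Gamma (β + 1) := by
  obtain ⟨_, hpos, hL⟩ := hS.law_one
  have hU : AEMeasurable (fun ω => (timeChange β α S t ω : ℝ)) P :=
    measurable_coe_nnreal_real.comp_aemeasurable (hS.aemeasurable_timeChange t)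
  have hg : Measurable fun x : ℝ => (((t ^ (α / β) : ℝ≥0) : ℝ) / x) ^ β := by fun_prop
  have hmap : P.map (fun ω => (timeChange β α S t ω : ℝ)) = _ := hS.map_inverseProcess hβ _
  have h := integral_div_rpow_pow_of_laplace hβ hpos hL (τ := (t ^ (α / β) : ℝ≥0))
    (NNReal.coe_nonneg _) 1
  simp only [pow_one, coe_rpow_div_rpow hβ, Nat.factorial_one, Nat.cast_one, mul_one,
    mul_one_div] at h
  constructor
  · have h1 : Integrable (fun x : ℝ => x) (P.map (fun ω => (timeChange β α S t ω : ℝ))) := by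
      rw [hmap, integrable_map_measure (by fun_prop) hg.aemeasurable]
      exact h.1
    exact (integrable_map_measure (by fun_prop) hU).1 h1
  · rw [← integral_map hU (f := fun x : ℝ => x) (by fun_prop), hmap,
      integral_map hg.aemeasurable (by fun_prop), h.2]

lemma IsStableSubordinator.integral_cexp_timeChange [IsProbabilityMeasure P] (hβ : 0 < β)
    (hS : IsStableSubordinator β S P) (t : ℝ≥0) (z : ℂ) :
    ∫ ω, Complex.exp (z * (timeChange β α S t ω : ℝ)) ∂P =
      mittagLeffler β (z * ((t : ℝ) ^ α : ℝ)) := by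
  obtain ⟨_, hpos, hL⟩ := hS.law_one
  have hU : AEMeasurable (fun ω => (timeChange β α S t ω : ℝ)) P :=
    measurable_coe_nnreal_real.comp_aemeasurable (hS.aemeasurable_timeChange t)
  have hg : Measurable fun x : ℝ => (((t ^ (α / β) : ℝ≥0) : ℝ) / x) ^ β := by fun_prop
  have hmap : P.map (fun ω => (timeChange β α S t ω : ℝ)) = _ := hS.map_inverseProcess hβ _
  have h := integral_cexp_div_rpow_of_laplace hβ hpos hL (τ := (t ^ (α / β) : ℝ≥0))
    (NNReal.coe_nonneg _) z
  rw [coe_rpow_div_rpow hβ] at h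
  rw [← h, ← integral_map hU (f := fun x : ℝ => Complex.exp (z * x)) (by fun_prop), hmap,
    integral_map hg.aemeasurable (by fun_prop)]

/-- Almost surely, both clock values are measurable functionals of the path of `S`, so they inherit
its independence from `W`. -/
lemma IsStableSubordinator.indepFun_timeChange (hS : IsStableSubordinator β S P)
    (hWS : IndepFun (fun ω t => W t ω) (fun ω t => S t ω) P) (s t : ℝ≥0) :
    IndepFun (fun ω t => W t ω) (fun ω => (timeChange β α S t ω, timeChange β α S s ω)) P := by
  have hψ : Measurable fun p : ℝ≥0 → ℝ =>
      (rationalFirstPassage (t ^ (α / β)) (fun q => p q),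
        rationalFirstPassage (s ^ (α / β)) (fun q => p q)) :=
    ((measurable_rationalFirstPassage _).comp (by fun_prop)).prodMk
      ((measurable_rationalFirstPassage _).comp (by fun_prop))
  refine (hWS.comp measurable_id hψ).congr Filter.EventuallyEq.rfl ?_
  filter_upwards [hS.inverseProcess_ae_eq (t ^ (α / β)),
    hS.inverseProcess_ae_eq (s ^ (α / β))] with ω h1 h2
  simp only [Function.comp_apply, timeChange, h1, h2]

lemma IsStableSubordinator.timeChange_zero [IsProbabilityMeasure P] (hβ : 0 < β) (hα : 0 < α)
    (hS : IsStableSubordinator β S P) : ∀ᵐ ω ∂P, timeChange β α S 0 ω = 0 := by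
  have h := hS.integral_timeChange (α := α) hβ 0
  -- The clock at `0` is nonnegative with mean `0`.
  rw [NNReal.coe_zero, Real.zero_rpow hα.ne', zero_div,
    integral_eq_zero_iff_of_nonneg (fun _ => NNReal.coe_nonneg _) h.1] at h
  filter_upwards [h.2] with ω hω
  exact NNReal.coe_eq_zero.1 hω

lemma IsStableSubordinator.timeChange_mono [IsProbabilityMeasure P] (hβ : 0 < β) (hα : 0 < α)
    (hS : IsStableSubordinator β S P) : ∀ᵐ ω ∂P, Monotone fun t => timeChange β α S t ω := by
  filter_upwards [hS.inverseProcess_mono] with ω hω s t hst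
  exact hω (NNReal.rpow_le_rpow hst (by positivity))

variable [IsProbabilityMeasure P]

/-- Writing the value as an increment from clock time `0` lets the results on random increments
cover the marginals too. -/
lemma timeChangedProcess_ae_eq (hβ : 0 < β) (hα : 0 < α) (hW : IsBrownianReal W P)
    (hS : IsStableSubordinator β S P) (t : ℝ≥0) :
    timeChangedProcess β α W S t =ᵐ[P] fun ω =>
      W (timeChange β α S t ω) ω - W (timeChange β α S 0 ω) ω := by
  filter_upwards [hS.timeChange_zero hβ hα, hW.eval_zero_ae_eq_zero] with ω h1 h2
  rw [h1, h2, sub_zero, timeChangedProcess]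

lemma aemeasurable_timeChangedProcess (hβ : 0 < β) (hα : 0 < α) (hW : IsBrownianReal W P)
    (hS : IsStableSubordinator β S P) (t : ℝ≥0) :
    AEMeasurable (timeChangedProcess β α W S t) P :=
  (hW.aemeasurable_randomIncrement (hS.aemeasurable_timeChange t)
    (hS.aemeasurable_timeChange 0)).congr (timeChangedProcess_ae_eq hβ hα hW hS t).symm

lemma charFun_timeChangedProcess (hβ : 0 < β) (hα : 0 < α) (hW : IsBrownianReal W P)
    (hS : IsStableSubordinator β S P)
    (hWS : IndepFun (fun ω t => W t ω) (fun ω t => S t ω) P) (t : ℝ≥0) (θ : ℝ) :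
    charFun (P.map (timeChangedProcess β α W S t)) θ =
      mittagLeffler β ((-(θ ^ 2 / 2) * (t : ℝ) ^ α : ℝ) : ℂ) := by
  rw [Measure.map_congr (timeChangedProcess_ae_eq hβ hα hW hS t),
    hW.charFun_randomIncrement (hS.aemeasurable_timeChange t) (hS.aemeasurable_timeChange 0)
      (hS.indepFun_timeChange hWS 0 t), Complex.ofReal_mul, ← hS.integral_cexp_timeChange hβ t]
  refine integral_congr_ae ?_
  filter_upwards [hS.timeChange_zero hβ hα] with ω hω
  simp [hω]

lemma integral_sq_timeChangedProcess_sub (hβ : 0 < β) (hα : 0 < α) (hW : IsBrownianReal W P)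
    (hS : IsStableSubordinator β S P)
    (hWS : IndepFun (fun ω t => W t ω) (fun ω t => S t ω) P) {s t : ℝ≥0} (hst : s ≤ t) :
    Integrable (fun ω =>
        (timeChangedProcess β α W S t ω - timeChangedProcess β α W S s ω) ^ 2) P ∧
      ∫ ω, (timeChangedProcess β α W S t ω - timeChangedProcess β α W S s ω) ^ 2 ∂P =
        ((t : ℝ) ^ α - (s : ℝ) ^ α) / Real.Gamma (β + 1) := by
  have hΓ : 0 < Real.Gamma (β + 1) := Real.Gamma_pos_of_pos (by positivity)
  have ht := hS.integral_timeChange (α := α) hβ t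
  have hs := hS.integral_timeChange (α := α) hβ s
  have hL : ∫⁻ ω, ENNReal.ofReal
      ((timeChangedProcess β α W S t ω - timeChangedProcess β α W S s ω) ^ 2) ∂P =
        ENNReal.ofReal (((t : ℝ) ^ α - (s : ℝ) ^ α) / Real.Gamma (β + 1)) := by
    refine (hW.lintegral_sq_randomIncrement (hS.aemeasurable_timeChange t)
      (hS.aemeasurable_timeChange s) (hS.indepFun_timeChange hWS s t)).trans ?_
    have hint : Integrable (fun ω =>
        (timeChange β α S t ω : ℝ) - (timeChange β α S s ω : ℝ)) P := ht.1.sub hs.1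
    -- By monotonicity of the clock the expected distance of its values is the difference of their
    -- means.
    rw [sub_div, ← ht.2, ← hs.2, ← integral_sub ht.1 hs.1,
      ofReal_integral_eq_lintegral_ofReal hint]
    · refine lintegral_congr_ae ?_
      filter_upwards [hS.timeChange_mono (α := α) hβ hα] with ω hω
      have h0 : (0 : ℝ) ≤ timeChange β α S t ω - timeChange β α S s ω :=
        sub_nonneg.2 (hω hst)
      rw [← ENNReal.ofReal_coe_nnreal, coe_nndist, Real.dist_eq, abs_of_nonneg h0]
    · filter_upwards [hS.timeChange_mono (α := α) hβ hα] with ω hω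
      exact sub_nonneg.2 (hω hst)
  have hm : AEMeasurable (fun ω =>
      (timeChangedProcess β α W S t ω - timeChangedProcess β α W S s ω) ^ 2) P :=
    ((aemeasurable_timeChangedProcess hβ hα hW hS t).sub
      (aemeasurable_timeChangedProcess hβ hα hW hS s)).pow_const 2
  have hnn : 0 ≤ᵐ[P] fun ω =>
      (timeChangedProcess β α W S t ω - timeChangedProcess β α W S s ω) ^ 2 :=
    ae_of_all _ fun ω => sq_nonneg _
  refine ⟨⟨hm.aestronglyMeasurable, ?_⟩, ?_⟩
  · rw [hasFiniteIntegral_iff_ofReal hnn, hL]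
    exact ENNReal.ofReal_lt_top
  · rw [integral_eq_lintegral_of_nonneg_ae hnn hm.aestronglyMeasurable, hL,
      ENNReal.toReal_ofReal]
    exact div_nonneg (sub_nonneg.2 (Real.rpow_le_rpow s.2 hst hα.le)) hΓ.le

end TimeChangedProcess

/-! ### Characteristic functions of generalized grey Brownian motion. -/

section GreyBrownianMotion

variable {Ω : Type*} [MeasurableSpace Ω] {P : Measure Ω} {β α : ℝ} {B : ℝ≥0 → Ω → ℝ}

lemma charFun_map_eq_integral {X : Ω → ℝ} (hX : AEMeasurable X P) (θ : ℝ) :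
    charFun (P.map X) θ = ∫ ω, Complex.exp (Complex.I * ((θ * X ω : ℝ) : ℂ)) ∂P := by
  rw [charFun_apply_real, integral_map hX (by fun_prop)]
  congr 1 with ω
  push_cast
  ring_nf

lemma IsGeneralizedGreyBM.charFun_eval (hα : 0 < α) (hB : IsGeneralizedGreyBM β α B P)
    (t : ℝ≥0) (θ : ℝ) :
    charFun (P.map (B t)) θ = mittagLeffler β ((-(θ ^ 2 / 2) * (t : ℝ) ^ α : ℝ) : ℂ) := by
  have h := hB.charFun_eq 1 ![t] (Subsingleton.strictMono _) ![θ]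
  rw [charFun_map_eq_integral (hB.aemeasurable t)]
  convert h using 3
  · simp
  · simp [Matrix.mulVec, dotProduct, ggBmMatrix, Real.zero_rpow hα.ne']
    ring

lemma IsGeneralizedGreyBM.charFun_sub (hα : 0 < α) (hB : IsGeneralizedGreyBM β α B P)
    {s t : ℝ≥0} (hst : s < t) (θ : ℝ) :
    charFun (P.map fun ω => B t ω - B s ω) θ =
      mittagLeffler β ((-(θ ^ 2 / 2) * ((t - s : ℝ≥0) : ℝ) ^ α : ℝ) : ℂ) := by
  have hst' : (s : ℝ) < t := hst
  -- With `(-θ, θ)` the terms `s ^ α` and `t ^ α` of the quadratic form cancel, leaving `θ ^ 2 * (t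
  -- - s) ^ α`.
  have h := hB.charFun_eq 2 ![s, t] (by
    intro i j hij
    fin_cases i <;> fin_cases j <;> simp_all) ![-θ, θ]
  have hm : AEMeasurable (fun ω => B t ω - B s ω) P :=
    (hB.aemeasurable t).sub (hB.aemeasurable s)
  rw [charFun_map_eq_integral hm]
  convert h using 3
  · simp only [Fin.sum_univ_two, Matrix.cons_val_zero, Matrix.cons_val_one]
    congr 3
    ring
  · rw [NNReal.coe_sub hst.le]
    simp [Matrix.mulVec, dotProduct, ggBmMatrix, Real.zero_rpow hα.ne', Fin.sum_univ_two,
      abs_sub_comm (s : ℝ) t, abs_of_pos (sub_pos.2 hst')]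
    ring

end GreyBrownianMotion

/-! ### Comparison of the two processes. -/

/-- Write `c ^ p = c * c ^ (p - 1)` and enlarge the last base to `a + b`, for `c = a` and `c = b`.
-/
lemma rpow_add_rpow_lt_add_rpow {a b p : ℝ} (ha : 0 < a) (hb : 0 < b) (hp : 1 < p) :
    a ^ p + b ^ p < (a + b) ^ p := by
  have h : ∀ c : ℝ, 0 < c → c < a + b → c ^ p < c * (a + b) ^ (p - 1) := by
    intro c hc hcab
    calc c ^ p = c * c ^ (p - 1) := by
          rw [← Real.rpow_one_add' hc.le (by linarith)]
          congr 1; ring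
      _ < _ := mul_lt_mul_of_pos_left (Real.rpow_lt_rpow hc.le hcab (by linarith)) hc
  calc a ^ p + b ^ p < a * (a + b) ^ (p - 1) + b * (a + b) ^ (p - 1) :=
        add_lt_add (h a ha (by linarith)) (h b hb (by linarith))
    _ = (a + b) ^ p := by
        rw [← add_mul, ← Real.rpow_one_add' (by positivity) (by linarith)]
        congr 1; ring

section SecondMoments

variable {Ω Ω' : Type*} [MeasurableSpace Ω] [MeasurableSpace Ω'] {P : Measure Ω}
  [IsProbabilityMeasure P] {Q : Measure Ω'} [IsProbabilityMeasure Q] {β α : ℝ}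
  {B : ℝ≥0 → Ω → ℝ} {W S : ℝ≥0 → Ω' → ℝ}

lemma IsGeneralizedGreyBM.identDistrib_timeChangedProcess (hβ : 0 < β) (hα : 0 < α)
    (hB : IsGeneralizedGreyBM β α B P) (hW : IsBrownianReal W Q)
    (hS : IsStableSubordinator β S Q)
    (hWS : IndepFun (fun ω t => W t ω) (fun ω t => S t ω) Q) (t : ℝ≥0) :
    IdentDistrib (B t) (timeChangedProcess β α W S t) P Q := by
  have hX := aemeasurable_timeChangedProcess hβ hα hW hS t
  have := Measure.isProbabilityMeasure_map (hB.aemeasurable t)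
  have := Measure.isProbabilityMeasure_map hX
  refine ⟨hB.aemeasurable t, hX, Measure.ext_of_charFun (funext fun θ => ?_)⟩
  rw [hB.charFun_eval hα, charFun_timeChangedProcess hβ hα hW hS hWS]

/-- The increment of a generalized grey Brownian motion over `[s, t]` is distributed as the
time-changed process at time `t - s`. -/
lemma IsGeneralizedGreyBM.identDistrib_sub_timeChangedProcess (hβ : 0 < β) (hα : 0 < α)
    (hB : IsGeneralizedGreyBM β α B P) (hW : IsBrownianReal W Q)
    (hS : IsStableSubordinator β S Q)
    (hWS : IndepFun (fun ω t => W t ω) (fun ω t => S t ω) Q) {s t : ℝ≥0} (hst : s < t) :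
    IdentDistrib (fun ω => B t ω - B s ω) (timeChangedProcess β α W S (t - s)) P Q := by
  have hX := aemeasurable_timeChangedProcess hβ hα hW hS (t - s)
  have hm : AEMeasurable (fun ω => B t ω - B s ω) P :=
    (hB.aemeasurable t).sub (hB.aemeasurable s)
  have := Measure.isProbabilityMeasure_map hm
  have := Measure.isProbabilityMeasure_map hX
  refine ⟨hm, hX, Measure.ext_of_charFun (funext fun θ => ?_)⟩
  rw [hB.charFun_sub hα hst, charFun_timeChangedProcess hβ hα hW hS hWS]

lemma IsGeneralizedGreyBM.integral_sq_sub (hβ : 0 < β) (hα : 0 < α)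
    (hB : IsGeneralizedGreyBM β α B P) (hW : IsBrownianReal W Q)
    (hS : IsStableSubordinator β S Q)
    (hWS : IndepFun (fun ω t => W t ω) (fun ω t => S t ω) Q) {s t : ℝ≥0} (hst : s ≤ t) :
    Integrable (fun ω => (B t ω - B s ω) ^ 2) P ∧
      ∫ ω, (B t ω - B s ω) ^ 2 ∂P = |(t : ℝ) - (s : ℝ)| ^ α / Real.Gamma (β + 1) := by
  rcases hst.eq_or_lt with rfl | hlt
  · simp [Real.zero_rpow hα.ne']
  have hid := (hB.identDistrib_sub_timeChangedProcess hβ hα hW hS hWS hlt).comp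
    (u := fun x : ℝ => x ^ 2) (by fun_prop)
  -- Used on `[0, t - s]`: since `X` vanishes at `0` almost surely, this is the second moment of `X
  -- (t - s)`.
  have h := integral_sq_timeChangedProcess_sub hβ hα hW hS hWS (zero_le (a := t - s))
  have h0 : (fun ω => (timeChangedProcess β α W S (t - s) ω -
      timeChangedProcess β α W S 0 ω) ^ 2) =ᵐ[Q]
        (fun x : ℝ => x ^ 2) ∘ timeChangedProcess β α W S (t - s) := by
    filter_upwards [timeChangedProcess_ae_eq hβ hα hW hS 0] with ω hω
    rw [hω, sub_self, sub_zero, Function.comp_apply]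
  rw [NNReal.coe_zero, Real.zero_rpow hα.ne', sub_zero, integral_congr_ae h0,
    NNReal.coe_sub hst] at h
  refine ⟨hid.integrable_iff.2 (h.1.congr h0), hid.integral_eq.trans ?_⟩
  rw [h.2, abs_of_nonneg (sub_nonneg.2 (NNReal.coe_le_coe.2 hst))]

lemma IsGeneralizedGreyBM.integral_sq_sub_ne (hβ : 0 < β) (hα : 1 < α)
    (hB : IsGeneralizedGreyBM β α B P) (hW : IsBrownianReal W Q)
    (hS : IsStableSubordinator β S Q)
    (hWS : IndepFun (fun ω t => W t ω) (fun ω t => S t ω) Q) {s t : ℝ≥0} (hs : 0 < s)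
    (hst : s < t) :
    ∫ ω, (B t ω - B s ω) ^ 2 ∂P ≠
      ∫ ω, (timeChangedProcess β α W S t ω - timeChangedProcess β α W S s ω) ^ 2 ∂Q := by
  have hα0 : 0 < α := by linarith
  have hst' : (0 : ℝ) < t - s := sub_pos.2 hst
  have hΓ : 0 < Real.Gamma (β + 1) := Real.Gamma_pos_of_pos (by positivity)
  rw [(hB.integral_sq_sub hβ hα0 hW hS hWS hst.le).2,
    (integral_sq_timeChangedProcess_sub hβ hα0 hW hS hWS hst.le).2, abs_of_pos hst']
  have h := rpow_add_rpow_lt_add_rpow (NNReal.coe_pos.2 hs) hst' hα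
  rw [add_sub_cancel] at h
  exact (div_lt_div_of_pos_right (by linarith) hΓ).ne

end SecondMoments

theorem mainTheorem3 {Ω Ω' : Type*} [MeasurableSpace Ω] [MeasurableSpace Ω']
    (P : Measure Ω) [IsProbabilityMeasure P] (Q : Measure Ω') [IsProbabilityMeasure Q]
    (β α : ℝ) (hβ0 : 0 < β) (hβ1 : β < 1) (hα1 : 1 < α) (hα2 : α < 2)
    (B : ℝ≥0 → Ω → ℝ) (hB : IsGeneralizedGreyBM β α B P)
    (W S : ℝ≥0 → Ω' → ℝ) (hW : IsBrownianReal W Q) (hS : IsStableSubordinator β S Q)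
    (hWS : IndepFun (fun ω t => W t ω) (fun ω t => S t ω) Q) :
    -- the one-dimensional distributions coincide, with the stated characteristic function
    (∀ t : ℝ≥0,
      IdentDistrib (B t) (timeChangedProcess β α W S t) P Q ∧
      ∀ θ : ℝ,
        ∫ ω, Complex.exp (Complex.I * ((θ * B t ω : ℝ) : ℂ)) ∂P =
            mittagLeffler β ((-(θ ^ 2 / 2) * (t : ℝ) ^ α : ℝ) : ℂ) ∧
        ∫ ω, Complex.exp (Complex.I * ((θ * timeChangedProcess β α W S t ω : ℝ) : ℂ)) ∂Q =
            mittagLeffler β ((-(θ ^ 2 / 2) * (t : ℝ) ^ α : ℝ) : ℂ)) ∧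
    -- second moments of the increments
    (∀ s t : ℝ≥0, s ≤ t →
      Integrable (fun ω => (B t ω - B s ω) ^ 2) P ∧
      ∫ ω, (B t ω - B s ω) ^ 2 ∂P = |(t : ℝ) - (s : ℝ)| ^ α / Real.Gamma (β + 1) ∧
      Integrable (fun ω =>
        (timeChangedProcess β α W S t ω - timeChangedProcess β α W S s ω) ^ 2) Q ∧
      ∫ ω, (timeChangedProcess β α W S t ω - timeChangedProcess β α W S s ω) ^ 2 ∂Q =
        ((t : ℝ) ^ α - (s : ℝ) ^ α) / Real.Gamma (β + 1)) ∧
    -- these second moments differ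
    (∀ s t : ℝ≥0, 0 < s → s < t →
      ∫ ω, (B t ω - B s ω) ^ 2 ∂P ≠
        ∫ ω, (timeChangedProcess β α W S t ω - timeChangedProcess β α W S s ω) ^ 2 ∂Q) ∧
    -- the joint distributions differ as soon as two distinct positive times are involved
    (∀ (n : ℕ) (t : Fin n → ℝ≥0), (∃ i j, 0 < t i ∧ t i < t j) →
      P.map (fun ω k => B (t k) ω) ≠
        Q.map (fun ω k => timeChangedProcess β α W S (t k) ω)) := by
  have hα0 : 0 < α := by linarith
  refine ⟨fun t => ⟨hB.identDistrib_timeChangedProcess hβ0 hα0 hW hS hWS t, fun θ => ⟨?_, ?_⟩⟩,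
    fun s t hst => ?_, fun s t hs hst => hB.integral_sq_sub_ne hβ0 hα1 hW hS hWS hs hst, ?_⟩
  · rw [← charFun_map_eq_integral (hB.aemeasurable t), hB.charFun_eval hα0]
  · rw [← charFun_map_eq_integral (aemeasurable_timeChangedProcess hβ0 hα0 hW hS t),
      charFun_timeChangedProcess hβ0 hα0 hW hS hWS]
  · have h1 := hB.integral_sq_sub hβ0 hα0 hW hS hWS hst
    have h2 := integral_sq_timeChangedProcess_sub hβ0 hα0 hW hS hWS hst
    exact ⟨h1.1, h1.2, h2.1, h2.2⟩
  · rintro n t ⟨i, j, hi, hij⟩ heq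
    -- Equal joint laws would give equal expectations of `(x j - x i) ^ 2`.
    refine hB.integral_sq_sub_ne hβ0 hα1 hW hS hWS hi hij ?_
    have hBm : AEMeasurable (fun ω k => B (t k) ω) P :=
      aemeasurable_pi_lambda _ fun k => hB.aemeasurable (t k)
    have hXm : AEMeasurable (fun ω k => timeChangedProcess β α W S (t k) ω) Q :=
      aemeasurable_pi_lambda _ fun k => aemeasurable_timeChangedProcess hβ0 hα0 hW hS (t k)
    exact ((IdentDistrib.mk hBm hXm heq).comp (u := fun x : Fin n → ℝ => (x j - x i) ^ 2)
      (by fun_prop)).integral_eq
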